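/- Let $p\ge 0$ be an integer, let $\alpha(1),\dots,\alpha(p)\ge 2$ be integers, and let $X_1,X_2,\dots$ be independent and identically distributed random vectors $X_k=(X_k^{(1)},\dots,X_k^{(p)})$ with $X_k^{(i)}\in A_i:=\{0,\dots,\alpha(i)-1\}$. Let $Y_k=(Y_k^{(1)},\dots,Y_k^{(p)})\in\{0,1\}^p$, $k\ge1$, be any sequence of random vectors such that $(Y_k)_{k\ge 1}$ is independent of $(X_k)_{k\ge 1}$. The value $X_k^{(i)}$ is observed if $Y_k^{(i)}=1$ and is missing if $Y_k^{(i)}=0$. For $i\ne j$ let $[i,j]$ be the set of those $k\in\{1,\dots,n\}$ for which neither $X_k^{(i)}$ nor $X_k^{(j)}$ is missing, and let $n(i,j)$ be its cardinality. For a finite set $A$, parameters $a(x)>0$ $(x\in A)$ and a finite sequence in $A$ in which each $x\in A$ occurs $c(x)$ times, the Bayes measure of the sequence is $$\frac{\Gamma\left(\sum_x a(x)\right)}{\Gamma\left(\sum_x (c(x)+a(x))\right)}\prod_{x\in A}\frac{\Gamma(c(x)+a(x))}{\Gamma(a(x))}.$$ Fix positive parameters $a_i(x)$, $x\in A_i$,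 for each $i$, and positive parameters $a_{i,j}(x,y)$, $(x,y)\in A_i\times A_j$, for each $i\neq j$. Let $Q^n_j(i)$, $Q^n_i(j)$ and $Q^n(i,j)$ be the Bayes measures of $(X_k^{(i)})_{k\in[i,j]}$, $(X_k^{(j)})_{k\in[i,j]}$ and $((X_k^{(i)},X_k^{(j)}))_{k\in[i,j]}$ with the parameters $a_i$, $a_j$ and $a_{i,j}$, respectively, and let $$J^n(i,j)=\frac1n\log\frac{Q^n(i,j)}{Q^n_j(i)\,Q^n_i(j)},\qquad K^n(i,j)=\frac1{n(i,j)}\log\frac{Q^n(i,j)}{Q^n_j(i)\,Q^n_i(j)},$$ where $K^n(i,j):=0$ if $n(i,j)=0$. Let $I(i,j)$ be the mutual information of $X_1^{(i)}$ and $X_1^{(j)}$. Assume that $P(X_1^{(i)}=x)>0$ for all $i$ and all $x\in A_i$, or that all the parameters $a_i(x)$ and $a_{i,j}(x,y)$ are equal to $1/2$. Suppose that, for all $i\ne j$, $n(i,j)\to\infty$ as $n\to\infty$ with probability one. Then, with probability one, for all sufficiently large $n$ and all $i\ne j$, $$J^n(i,j)\le 0\iff I(i,j)=0\iff K^n(i,j)\le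 0 .$$ -/

import Mathlib

open MeasureTheory ProbabilityTheory Filter

namespace IncompleteData

/-- A data frame with columns indexed by `Fin p` and rows indexed by `ℕ`. Column `i` takes values in
`{0, …, α i - 1}` and the entry `none` stands for a missing value. The `n` samples are the rows
`0, …, n - 1`. -/
abbrev Frame {p : ℕ} (α : Fin p → ℕ) : Type :=
  ℕ → (i : Fin p) → Option (Fin (α i))

/-- The data frame obtained from the complete samples `x` by deleting the entry `(k, i)`
whenever `y k i = false`. -/
def mask {p : ℕ} {α : Fin p → ℕ} (x : ℕ → (i : Fin p) → Fin (α i)) (y : ℕ → Fin p → Bool) :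
    Frame α :=
  fun k i => if y k i then some (x k i) else none

/-- The set `[i,j]` of those among the first `n` rows in which neither the value of
column `i` nor the value of column `j` is missing. -/
def rows {p : ℕ} {α : Fin p → ℕ} (d : Frame α) (n : ℕ) (i j : Fin p) : Finset ℕ :=
  (Finset.range n).filter (fun k => (d k i).isSome ∧ (d k j).isSome)

/-- `n(i,j)`, the number of samples in which both `i` and `j` are observed. -/
def numObs {p : ℕ} {α : Fin p → ℕ} (d : Frame α) (n : ℕ) (i j : Fin p) : ℕ :=
  (rows d n i j).card

/-- The number of rows in the set `S` in which the value `x` occurs in column `i`. -/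
def count {p : ℕ} {α : Fin p → ℕ} (d : Frame α) (S : Finset ℕ) (i : Fin p) (x : Fin (α i)) : ℕ :=
  (S.filter (fun k => d k i = some x)).card

/-- The number of rows in the set `S` in which the pair of values `(x, y)` occurs in
the columns `i` and `j`. -/
def pairCount {p : ℕ} {α : Fin p → ℕ} (d : Frame α) (S : Finset ℕ) (i j : Fin p)
    (z : Fin (α i) × Fin (α j)) : ℕ :=
  (S.filter (fun k => d k i = some z.1 ∧ d k j = some z.2)).card

/-- The Bayes measure, with Dirichlet parameters `a`, of a sequence in which each value `x`
occurs `c x` times. -/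
noncomputable def bayesMeasure {A : Type*} [Fintype A] (a : A → ℝ) (c : A → ℕ) : ℝ :=
  Real.Gamma (∑ x, a x) / Real.Gamma (∑ x, ((c x : ℝ) + a x)) *
    ∏ x, (Real.Gamma ((c x : ℝ) + a x) / Real.Gamma (a x))

section Estimators

variable {p : ℕ} {α : Fin p → ℕ}

/-- The Bayes measure `Q_j^n(i)` of the values of column `i` in the rows `[i,j]`; with the arguments
`(j, i)` it is `Q_i^n(j)`. -/
noncomputable def qMarg (a : (i : Fin p) → Fin (α i) → ℝ) (d : Frame α) (n : ℕ) (i j : Fin p) : ℝ :=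
  bayesMeasure (a i) (count d (rows d n i j) i)

/-- The Bayes measure `Q^n(i,j)` of the pairs of values of the columns `i, j` in the rows `[i,j]`. -/
noncomputable def qJoint (b : (i j : Fin p) → Fin (α i) × Fin (α j) → ℝ) (d : Frame α) (n : ℕ)
    (i j : Fin p) : ℝ :=
  bayesMeasure (b i j) (pairCount d (rows d n i j) i j)

/-- The estimator `J^n(i,j)`. -/
noncomputable def estJ (a : (i : Fin p) → Fin (α i) → ℝ)
    (b : (i j : Fin p) → Fin (α i) × Fin (α j) → ℝ) (d : Frame α) (n : ℕ) (i j : Fin p) : ℝ :=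
  1 / (n : ℝ) * Real.log (qJoint b d n i j / (qMarg a d n i j * qMarg a d n j i))

/-- The estimator `K^n(i,j)`. -/
noncomputable def estK (a : (i : Fin p) → Fin (α i) → ℝ)
    (b : (i j : Fin p) → Fin (α i) × Fin (α j) → ℝ) (d : Frame α) (n : ℕ) (i j : Fin p) : ℝ :=
  1 / (numObs d n i j : ℝ) * Real.log (qJoint b d n i j / (qMarg a d n i j * qMarg a d n j i))

end Estimators

/-- The mutual information of two random variables with finitely many values. -/
noncomputable def mutualInfo {Ω A B : Type*} [MeasurableSpace Ω] [Fintype A] [Fintype B]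
    (P : Measure Ω) (U : Ω → A) (V : Ω → B) : ℝ :=
  ∑ x, ∑ y, P.real {ω | U ω = x ∧ V ω = y} *
    Real.log (P.real {ω | U ω = x ∧ V ω = y} / (P.real {ω | U ω = x} * P.real {ω | V ω = y}))

end IncompleteData

open scoped Topology NNReal ENNReal

namespace IncompleteData

/-! ### Stirling's formula for the Gamma function along shifted integers -/

/-! Let `c` be the table of pair counts in the `N = n(i,j)` rows where both columns are observed.
Stirling's formula turns a Bayes measure into the maximised log-likelihood `logLik` minus half of
`log N` per free parameter, up to a bounded error (`exists_eventually_abs_log_bayesMeasure_sub_le`).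
In the log ratio the parameter counts combine to `|A||B| - 1 - (|A| - 1) - (|B| - 1) = (|A| - 1)(|B|
- 1)`, which is at least 1, so the log ratio is `empMutualInfo c` minus at least `(1/2) log N`, up
to a constant.

If the mutual information is positive, the log ratio divided by `N` tends to it, so the ratio is
eventually positive. If it vanishes, `empMutualInfo` is at most a chi-square statistic
(`empMutualInfo_le_chi_sq`). Its deviations are sums of independent bounded centred variables, and a
weak law of the iterated logarithm (`ae_eventually_sum_lt`) makes the statistic `o(log N)`, so the
penalty wins.

For missing values, independence and Fubini allow the pattern to be frozen (`ae_of_forall_pattern`).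
The rows picked by a fixed infinite pattern are again i.i.d., and the table after `n` rows is the
table of that subsequence at size `n(i,j)`. Both estimators are positive multiples of the same log
ratio, hence share its sign. -/

theorem tendsto_log_factorial_sub :
    Tendsto (fun n : ℕ => Real.log (n.factorial : ℝ) - (n * Real.log n - n + 1 / 2 * Real.log n))
      atTop (𝓝 (Real.log √Real.pi + Real.log 2 / 2)) := by
  have h1 : Tendsto (fun n => Real.log (Stirling.stirlingSeq n)) atTop (𝓝 (Real.log √Real.pi)) :=
    Stirling.tendsto_stirlingSeq_sqrt_pi.log (by positivity)
  have h2 := h1.add_const (Real.log 2 / 2)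
  refine h2.congr' ?_
  filter_upwards [eventually_gt_atTop 0] with n hn
  have hn' : (n : ℝ) ≠ 0 := by positivity
  rw [Stirling.log_stirlingSeq_formula, Real.log_mul (by norm_num) hn',
    Real.log_div hn' (Real.exp_ne_zero 1), Real.log_exp]
  ring

theorem tendsto_log_natCast_add_sub_log (a : ℝ) :
    Tendsto (fun n : ℕ => Real.log (n + a) - Real.log n) atTop (𝓝 0) := by
  have h := (Real.tendsto_log_comp_add_sub_log a).comp tendsto_natCast_atTop_atTop
  exact h

theorem log_Gamma_natCast_add {a : ℝ} (ha : 0 < a) (n : ℕ) :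
    Real.log (Real.Gamma (n + a)) =
      Real.log (Real.Gamma a) + ∑ m ∈ Finset.range n, Real.log (a + m) := by
  induction n with
  | zero => simp
  | succ n ih =>
    have h : (0 : ℝ) < n + a := by positivity
    rw [Finset.sum_range_succ, ← add_assoc, ← ih, Nat.cast_succ, add_right_comm,
      Real.Gamma_add_one h.ne', Real.log_mul h.ne' (Real.Gamma_pos_of_pos h).ne', add_comm a,
      add_comm]

/-- Euler's limit for `log Γ(a)` combined with Stirling's formula for `n!` shows that the difference
converges, so it is bounded over all `n`. The case `n = 0` is included, with `Real.log 0 = 0`; this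
allows values that never occur. -/
theorem exists_abs_log_Gamma_natCast_add_sub_le {a : ℝ} (ha : 0 < a) :
    ∃ C : ℝ, ∀ n : ℕ, |Real.log (Real.Gamma (n + a)) -
      (n * Real.log n - n + (a - 1 / 2) * Real.log n)| ≤ C := by
  have h1 := Real.BohrMollerup.tendsto_log_gamma ha
  -- `logGammaSeq` sums up to `log (a + n)`, one term more than `log Γ(n + a)` needs; the last limit
  -- removes it.
  have h2 := ((tendsto_log_factorial_sub.add (h1.const_sub (Real.log (Real.Gamma a)))).sub
    (tendsto_log_natCast_add_sub_log a))
  have h3 : Tendsto (fun n : ℕ => Real.log (Real.Gamma (n + a)) -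
      (n * Real.log n - n + (a - 1 / 2) * Real.log n)) atTop
      (𝓝 (Real.log √Real.pi + Real.log 2 / 2 +
        (Real.log (Real.Gamma a) - Real.log (Real.Gamma a)) - 0)) := by
    refine h2.congr fun n => ?_
    rw [log_Gamma_natCast_add ha, Real.BohrMollerup.logGammaSeq, Finset.sum_range_succ, add_comm a]
    ring
  obtain ⟨C, hC⟩ := (Metric.isBounded_range_of_tendsto _ h3).exists_norm_le
  exact ⟨C, fun n => hC _ ⟨n, rfl⟩⟩

/-! ### Bayes measures -/

section Bayes

variable {A : Type*} [Fintype A]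

theorem bayesMeasure_pos [Nonempty A] {a : A → ℝ} (ha : ∀ x, 0 < a x) (c : A → ℕ) :
    0 < bayesMeasure a c := by
  have h1 : 0 < ∑ x, a x := Finset.sum_pos (fun x _ => ha x) Finset.univ_nonempty
  have h2 : 0 < ∑ x, ((c x : ℝ) + a x) :=
    Finset.sum_pos (fun x _ => by have := ha x; positivity) Finset.univ_nonempty
  refine mul_pos (div_pos (Real.Gamma_pos_of_pos h1) (Real.Gamma_pos_of_pos h2))
    (Finset.prod_pos fun x _ => div_pos (Real.Gamma_pos_of_pos ?_) (Real.Gamma_pos_of_pos (ha x)))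
  have := ha x
  positivity

theorem log_bayesMeasure [Nonempty A] {a : A → ℝ} (ha : ∀ x, 0 < a x) (c : A → ℕ) :
    Real.log (bayesMeasure a c) =
      Real.log (Real.Gamma (∑ x, a x)) - Real.log (Real.Gamma ((∑ x, c x : ℕ) + ∑ x, a x)) +
        ∑ x, (Real.log (Real.Gamma (c x + a x)) - Real.log (Real.Gamma (a x))) := by
  have h1 : 0 < ∑ x, a x := Finset.sum_pos (fun x _ => ha x) Finset.univ_nonempty
  have h2 : 0 < ((∑ x, c x : ℕ) : ℝ) + ∑ x, a x := by positivity
  have h3 : ∀ x, 0 < (c x : ℝ) + a x := fun x => by have := ha x; positivity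
  have g1 := (Real.Gamma_pos_of_pos h1).ne'
  have g2 := (Real.Gamma_pos_of_pos h2).ne'
  have g3 := fun x => (Real.Gamma_pos_of_pos (h3 x)).ne'
  have g4 := fun x => (Real.Gamma_pos_of_pos (ha x)).ne'
  rw [bayesMeasure, Finset.sum_add_distrib, ← Nat.cast_sum,
    Real.log_mul (div_ne_zero g1 g2)
      (Finset.prod_ne_zero_iff.2 fun x _ => div_ne_zero (g3 x) (g4 x)),
    Real.log_div g1 g2, Real.log_prod (fun x _ => div_ne_zero (g3 x) (g4 x))]
  congr 1
  exact Finset.sum_congr rfl fun x _ => Real.log_div (g3 x) (g4 x)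

/-- The sum `∑ c log c - N log N` with `N = ∑ c`, that is `-N` times the empirical entropy. -/
noncomputable def logLik (c : A → ℕ) : ℝ :=
  ∑ x, (c x : ℝ) * Real.log (c x) - (∑ x, c x : ℕ) * Real.log (∑ x, c x : ℕ)

/-- Stirling is applied to each Gamma factor; the linear terms `-c x` and `+N` cancel. The constant
does not depend on the counts. -/
theorem exists_abs_log_bayesMeasure_sub_le [Nonempty A] {a : A → ℝ} (ha : ∀ x, 0 < a x) :
    ∃ C : ℝ, ∀ c : A → ℕ, |Real.log (bayesMeasure a c) -
      (logLik c + ∑ x, (a x - 1 / 2) * Real.log (c x) -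
        (∑ x, a x - 1 / 2) * Real.log (∑ x, c x : ℕ))| ≤ C := by
  have h1 : 0 < ∑ x, a x := Finset.sum_pos (fun x _ => ha x) Finset.univ_nonempty
  obtain ⟨C₀, hC₀⟩ := exists_abs_log_Gamma_natCast_add_sub_le h1
  choose C hC using fun x => exists_abs_log_Gamma_natCast_add_sub_le (ha x)
  refine ⟨|Real.log (Real.Gamma (∑ x, a x))| + C₀ +
    ∑ x, (C x + |Real.log (Real.Gamma (a x))|), fun c => ?_⟩
  rw [log_bayesMeasure ha]
  have e0 := hC₀ (∑ x, c x)
  have e1 : |∑ x, ((Real.log (Real.Gamma (c x + a x)) -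
      (c x * Real.log (c x) - c x + (a x - 1 / 2) * Real.log (c x))) -
        Real.log (Real.Gamma (a x)))| ≤ ∑ x, (C x + |Real.log (Real.Gamma (a x))|) := by
    refine (Finset.abs_sum_le_sum_abs _ _).trans (Finset.sum_le_sum fun x _ => ?_)
    exact (abs_sub _ _).trans (add_le_add (hC x _) le_rfl)
  have e2 := abs_nonneg (Real.log (Real.Gamma (∑ x, a x)))
  have e3 := neg_abs_le (Real.log (Real.Gamma (∑ x, a x)))
  have e4 := le_abs_self (Real.log (Real.Gamma (∑ x, a x)))
  simp only [Finset.sum_sub_distrib, Finset.sum_add_distrib, ← Nat.cast_sum] at e1 ⊢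
  rw [logLik]
  rw [abs_le] at e0 e1 ⊢
  constructor <;> linarith [e0.1, e0.2, e1.1, e1.2]

end Bayes

/-! ### Information-theoretic inequalities -/

theorem mul_log_add_sub_le {u v : ℝ} (hu : 0 ≤ u) (hv : 0 ≤ v) (h : v = 0 → u = 0) :
    u * Real.log v + (u - v) ≤ u * Real.log u := by
  rcases hu.eq_or_lt with rfl | hu
  · simpa using hv
  have hv : 0 < v := hv.lt_of_ne fun h' => hu.ne' (h h'.symm)
  have h1 := mul_le_mul_of_nonneg_left (Real.log_le_sub_one_of_pos (div_pos hv hu)) hu.le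
  rw [Real.log_div hv.ne' hu.ne', mul_sub, mul_sub, mul_div_cancel₀ _ hu.ne'] at h1
  linarith

/-- Now `log t ≤ t - 1` is used at `t = u / v` instead of `v / u`: this is the pointwise form of the
bound of relative entropy by chi-square. -/
theorem mul_log_le_add_sq_div {u v : ℝ} (hu : 0 ≤ u) (hv : 0 ≤ v) (h : v = 0 → u = 0) :
    u * Real.log u ≤ u * Real.log v + (u - v) ^ 2 / v + (u - v) := by
  rcases hv.eq_or_lt with rfl | hv
  · simp [h rfl]
  have e : (u - v) ^ 2 / v + (u - v) = u * (u / v - 1) := by field_simp; ring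
  rw [add_assoc, e]
  rcases hu.eq_or_lt with rfl | hu
  · simp
  have h1 := mul_le_mul_of_nonneg_left (Real.log_le_sub_one_of_pos (div_pos hu hv)) hu.le
  rw [Real.log_div hu.ne' hv.ne', mul_sub] at h1
  linarith

/-! ### Mutual information of a joint distribution and of a table of counts. -/

section Joint

variable {A B : Type*} [Fintype A] [Fintype B]

/-- The mutual information of a joint probability mass function. -/
noncomputable def pmfMutualInfo (p : A × B → ℝ) : ℝ :=
  ∑ x, ∑ y, p (x, y) * Real.log (p (x, y) / ((∑ y', p (x, y')) * ∑ x', p (x', y)))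

theorem eq_zero_of_marginal_mul_eq_zero {p : A × B → ℝ} (hp : ∀ z, 0 ≤ p z) {x : A} {y : B}
    (h : (∑ y', p (x, y')) * (∑ x', p (x', y)) = 0) : p (x, y) = 0 := by
  rcases mul_eq_zero.1 h with h | h
  · exact (Finset.sum_eq_zero_iff_of_nonneg fun y' _ => hp (x, y')).1 h y (Finset.mem_univ y)
  · exact (Finset.sum_eq_zero_iff_of_nonneg fun x' _ => hp (x', y)).1 h x (Finset.mem_univ x)

/-- The added differences sum to `1 - 1 = 0`, and they make every summand nonnegative. Nonnegativity
and the equality case can then be read off term by term. -/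
theorem pmfMutualInfo_eq_sum {p : A × B → ℝ} (hp : ∀ z, 0 ≤ p z) (hsum : ∑ z, p z = 1) :
    pmfMutualInfo p = ∑ z : A × B, (p z * Real.log (p z) -
      (p z * Real.log ((∑ y', p (z.1, y')) * ∑ x', p (x', z.2)) +
        (p z - (∑ y', p (z.1, y')) * ∑ x', p (x', z.2)))) := by
  have h1 : ∑ z : A × B, (∑ y', p (z.1, y')) * (∑ x', p (x', z.2)) = 1 := by
    rw [Fintype.sum_prod_type]
    simp only [← Finset.mul_sum, ← Finset.sum_mul]
    rw [← Fintype.sum_prod_type, ← Fintype.sum_prod_type_right, hsum, one_mul]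
  rw [Finset.sum_sub_distrib, Finset.sum_add_distrib, Finset.sum_sub_distrib, hsum, h1, sub_self,
    add_zero, ← Finset.sum_sub_distrib, pmfMutualInfo, ← Fintype.sum_prod_type']
  refine Finset.sum_congr rfl fun z _ => ?_
  rcases eq_or_ne (p z) 0 with h | h
  · simp [h]
  · have h2 : (∑ y', p (z.1, y')) * (∑ x', p (x', z.2)) ≠ 0 := fun h' =>
      h (eq_zero_of_marginal_mul_eq_zero hp h')
    rw [Real.log_div h h2]
    ring

theorem marginal_mul_nonneg {p : A × B → ℝ} (hp : ∀ z, 0 ≤ p z) (z : A × B) :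
    0 ≤ (∑ y', p (z.1, y')) * ∑ x', p (x', z.2) :=
  mul_nonneg (Finset.sum_nonneg fun _ _ => hp _) (Finset.sum_nonneg fun _ _ => hp _)

theorem pmfMutualInfo_nonneg {p : A × B → ℝ} (hp : ∀ z, 0 ≤ p z) (hsum : ∑ z, p z = 1) :
    0 ≤ pmfMutualInfo p := by
  rw [pmfMutualInfo_eq_sum hp hsum]
  exact Finset.sum_nonneg fun z _ => sub_nonneg.2
    (mul_log_add_sub_le (hp z) (marginal_mul_nonneg hp z)
      fun h => eq_zero_of_marginal_mul_eq_zero hp h)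

theorem mul_log_add_sub_lt {u v : ℝ} (hu : 0 ≤ u) (hv : 0 ≤ v) (h : v = 0 → u = 0)
    (huv : u ≠ v) : u * Real.log v + (u - v) < u * Real.log u := by
  rcases hu.eq_or_lt with rfl | hu
  · simpa using hv.lt_of_ne huv
  have hv : 0 < v := hv.lt_of_ne fun h' => hu.ne' (h h'.symm)
  have h1 := mul_lt_mul_of_pos_left (Real.log_lt_sub_one_of_pos (div_pos hv hu)
    fun h' => huv ((div_eq_one_iff_eq hu.ne').1 h').symm) hu
  rw [Real.log_div hv.ne' hu.ne', mul_sub, mul_sub, mul_div_cancel₀ _ hu.ne'] at h1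
  linarith

theorem eq_marginal_mul_of_pmfMutualInfo_eq_zero {p : A × B → ℝ} (hp : ∀ z, 0 ≤ p z)
    (hsum : ∑ z, p z = 1) (h : pmfMutualInfo p = 0) (z : A × B) :
    p z = (∑ y', p (z.1, y')) * ∑ x', p (x', z.2) := by
  by_contra hne
  rw [pmfMutualInfo_eq_sum hp hsum, Finset.sum_eq_zero_iff_of_nonneg fun z _ => sub_nonneg.2
    (mul_log_add_sub_le (hp z) (marginal_mul_nonneg hp z)
      fun h => eq_zero_of_marginal_mul_eq_zero hp h)] at h
  have h1 := mul_log_add_sub_lt (hp z) (marginal_mul_nonneg hp z)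
    (fun h => eq_zero_of_marginal_mul_eq_zero hp h) hne
  have h2 := h z (Finset.mem_univ z)
  linarith

theorem pmfMutualInfo_eq_entropies {p : A × B → ℝ} (hp : ∀ z, 0 ≤ p z) :
    pmfMutualInfo p = ∑ z, p z * Real.log (p z)
      - ∑ x, (∑ y, p (x, y)) * Real.log (∑ y, p (x, y))
      - ∑ y, (∑ x, p (x, y)) * Real.log (∑ x, p (x, y)) := by
  simp only [Finset.sum_mul]
  rw [← Fintype.sum_prod_type' (fun x y => p (x, y) * Real.log (∑ y, p (x, y))),
    ← Fintype.sum_prod_type_right' (fun x y => p (x, y) * Real.log (∑ x, p (x, y))),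
    ← Finset.sum_sub_distrib, ← Finset.sum_sub_distrib, pmfMutualInfo, ← Fintype.sum_prod_type']
  refine Finset.sum_congr rfl fun z _ => ?_
  rcases eq_or_ne (p z) 0 with h | h
  · simp [h]
  · have h2 : (∑ y', p (z.1, y')) * (∑ x', p (x', z.2)) ≠ 0 := fun h' =>
      h (eq_zero_of_marginal_mul_eq_zero hp h')
    rw [Real.log_div h h2, Real.log_mul (left_ne_zero_of_mul h2) (right_ne_zero_of_mul h2)]
    ring

theorem sum_mul_log_sum_mul {p : A → ℝ} {c : A → ℕ} (hN : (0 : ℝ) < (∑ x, c x : ℕ))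
    (hc : ∀ x, p x = 0 → c x = 0) :
    ∑ x, (c x : ℝ) * Real.log ((∑ x', c x' : ℕ) * p x) =
      (∑ x, c x : ℕ) * Real.log (∑ x, c x : ℕ) + ∑ x, (c x : ℝ) * Real.log (p x) := by
  set N := ∑ x, c x with hN'
  rw [hN', Nat.cast_sum, Finset.sum_mul, ← Finset.sum_add_distrib, ← Nat.cast_sum, ← hN']
  refine Finset.sum_congr rfl fun x _ => ?_
  rcases eq_or_ne (p x) 0 with h | h
  · simp [hc x h]
  · rw [Real.log_mul hN.ne' h, mul_add]

/-- The logarithmic likelihood of counts dominates the cross entropy with any distribution. -/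
theorem sum_mul_log_le_logLik {p : A → ℝ} (hp : ∀ x, 0 ≤ p x) (hsum : ∑ x, p x = 1) {c : A → ℕ}
    (hc : ∀ x, p x = 0 → c x = 0) : ∑ x, (c x : ℝ) * Real.log (p x) ≤ logLik c := by
  set N := ∑ x, c x with hN
  rcases Nat.eq_zero_or_pos N with h0 | h0
  · have : ∀ x, c x = 0 := fun x => (Finset.sum_eq_zero_iff.1 h0) x (Finset.mem_univ x)
    simp [logLik, this]
  have hN0 : (0 : ℝ) < N := by exact_mod_cast h0
  have key : ∑ x, ((c x : ℝ) * Real.log (N * p x) + (c x - N * p x)) ≤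
      ∑ x, (c x : ℝ) * Real.log (c x) := Finset.sum_le_sum fun x _ =>
    mul_log_add_sub_le (by positivity) (mul_nonneg hN0.le (hp x)) fun h => by
      rw [hc x ((mul_eq_zero.1 h).resolve_left hN0.ne'), Nat.cast_zero]
  rw [Finset.sum_add_distrib, Finset.sum_sub_distrib, ← Finset.mul_sum, hsum, ← Nat.cast_sum, ← hN,
    hN, sum_mul_log_sum_mul hN0 hc, ← hN] at key
  rw [logLik, ← hN]
  linarith

theorem logLik_le_sum_mul_log_add {p : A → ℝ} (hp : ∀ x, 0 ≤ p x) (hsum : ∑ x, p x = 1)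
    {c : A → ℕ} (hc : ∀ x, p x = 0 → c x = 0) :
    logLik c ≤ ∑ x, (c x : ℝ) * Real.log (p x) +
      ∑ x, ((c x : ℝ) - (∑ x', c x' : ℕ) * p x) ^ 2 / ((∑ x', c x' : ℕ) * p x) := by
  set N := ∑ x, c x with hN
  rcases Nat.eq_zero_or_pos N with h0 | h0
  · have : ∀ x, c x = 0 := fun x => (Finset.sum_eq_zero_iff.1 h0) x (Finset.mem_univ x)
    simp [logLik, this, h0]
  have hN0 : (0 : ℝ) < N := by exact_mod_cast h0
  have key : ∑ x, (c x : ℝ) * Real.log (c x) ≤ ∑ x, ((c x : ℝ) * Real.log (N * p x) +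
      (c x - N * p x) ^ 2 / (N * p x) + (c x - N * p x)) := Finset.sum_le_sum fun x _ =>
    mul_log_le_add_sq_div (by positivity) (mul_nonneg hN0.le (hp x)) fun h => by
      rw [hc x ((mul_eq_zero.1 h).resolve_left hN0.ne'), Nat.cast_zero]
  rw [Finset.sum_add_distrib, Finset.sum_add_distrib, Finset.sum_sub_distrib, ← Finset.mul_sum,
    hsum, ← Nat.cast_sum, ← hN, hN,
    sum_mul_log_sum_mul hN0 hc, ← hN] at key
  rw [logLik, ← hN]
  linarith

/-- The empirical mutual information times the sample size. -/
noncomputable def empMutualInfo (c : A × B → ℕ) : ℝ :=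
  logLik c - logLik (fun x => ∑ y, c (x, y)) - logLik (fun y => ∑ x, c (x, y))

/-- Under independence the cross entropy of the counts with `p` splits into its two marginal parts.
Each marginal `logLik` is at least its part by Gibbs' inequality, while the joint one exceeds the
whole by at most chi-square. -/
theorem empMutualInfo_le_chi_sq {p : A × B → ℝ} (hp : ∀ z, 0 ≤ p z) (hsum : ∑ z, p z = 1)
    (hind : ∀ z : A × B, p z = (∑ y', p (z.1, y')) * ∑ x', p (x', z.2)) {c : A × B → ℕ}
    (hc : ∀ z, p z = 0 → c z = 0) :
    empMutualInfo c ≤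
      ∑ z, ((c z : ℝ) - (∑ z', c z' : ℕ) * p z) ^ 2 / ((∑ z', c z' : ℕ) * p z) := by
  have h1 : ∑ x, ((∑ y, c (x, y) : ℕ) : ℝ) * Real.log (∑ y, p (x, y)) ≤
      logLik (fun x => ∑ y, c (x, y)) :=
    sum_mul_log_le_logLik (fun x => Finset.sum_nonneg fun y _ => hp _)
      (by rw [← Fintype.sum_prod_type, hsum]) fun x hx => Finset.sum_eq_zero fun y _ =>
        hc _ ((Finset.sum_eq_zero_iff_of_nonneg fun y _ => hp (x, y)).1 hx y (Finset.mem_univ y))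
  have h2 : ∑ y, ((∑ x, c (x, y) : ℕ) : ℝ) * Real.log (∑ x, p (x, y)) ≤
      logLik (fun y => ∑ x, c (x, y)) :=
    sum_mul_log_le_logLik (fun y => Finset.sum_nonneg fun x _ => hp _)
      (by rw [← Fintype.sum_prod_type_right, hsum]) fun y hy => Finset.sum_eq_zero fun x _ =>
        hc _ ((Finset.sum_eq_zero_iff_of_nonneg fun x _ => hp (x, y)).1 hy x (Finset.mem_univ x))
  have h3 := logLik_le_sum_mul_log_add hp hsum hc
  have h4 : ∑ z, (c z : ℝ) * Real.log (p z) =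
      ∑ x, ((∑ y, c (x, y) : ℕ) : ℝ) * Real.log (∑ y, p (x, y)) +
      ∑ y, ((∑ x, c (x, y) : ℕ) : ℝ) * Real.log (∑ x, p (x, y)) := by
    simp only [Nat.cast_sum, Finset.sum_mul]
    rw [← Fintype.sum_prod_type' (fun x y => (c (x, y) : ℝ) * Real.log (∑ y, p (x, y))),
      ← Fintype.sum_prod_type_right' (fun x y => (c (x, y) : ℝ) * Real.log (∑ x, p (x, y))),
      ← Finset.sum_add_distrib]
    refine Finset.sum_congr rfl fun z _ => ?_
    rcases eq_or_ne (p z) 0 with h | h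
    · simp [hc z h]
    · have h' := h
      rw [hind z] at h'
      rw [hind z, Real.log_mul (left_ne_zero_of_mul h') (right_ne_zero_of_mul h'), mul_add]
  rw [empMutualInfo]
  linarith

end Joint

/-! ### Asymptotics of Bayes measures along a sequence of counts -/

theorem tendsto_log_natCast_div_natCast :
    Tendsto (fun N : ℕ => Real.log N / N) atTop (𝓝 0) := by
  have h := Real.isLittleO_log_id_atTop.tendsto_div_nhds_zero
  exact h.comp tendsto_natCast_atTop_atTop

/-! ### Growth of a single Bayes measure. -/

section Single

variable {A : Type*} [Fintype A] {c : ℕ → A → ℕ} {p : A → ℝ}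

/-- `logLik / N` is the sum of `t log t` over the frequencies, and `t log t` is continuous even at
0. -/
theorem tendsto_logLik_div (hc : ∀ N, ∑ x, c N x = N)
    (hlim : ∀ x, Tendsto (fun N => (c N x : ℝ) / N) atTop (𝓝 (p x))) :
    Tendsto (fun N => logLik (c N) / N) atTop (𝓝 (∑ x, p x * Real.log (p x))) := by
  have h : Tendsto (fun N => ∑ x, ((c N x : ℝ) / N) * Real.log ((c N x : ℝ) / N)) atTop
      (𝓝 (∑ x, p x * Real.log (p x))) :=
    tendsto_finsetSum _ fun x _ => (Real.continuous_mul_log.tendsto (p x)).comp (hlim x)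
  refine h.congr' ?_
  filter_upwards [eventually_gt_atTop 0] with N hN
  have hN0 : (N : ℝ) ≠ 0 := by positivity
  have e : (N : ℝ) * Real.log N = ∑ x, (c N x : ℝ) * Real.log N := by
    rw [← Finset.sum_mul, ← Nat.cast_sum, hc]
  rw [logLik, hc, e, ← Finset.sum_sub_distrib, Finset.sum_div]
  refine Finset.sum_congr rfl fun x _ => ?_
  rcases eq_or_ne (c N x : ℝ) 0 with h0 | h0
  · simp [h0]
  · rw [Real.log_div h0 hN0]
    ring

theorem tendsto_log_bayesMeasure_div [Nonempty A] {a : A → ℝ} (ha : ∀ x, 0 < a x)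
    (hc : ∀ N, ∑ x, c N x = N) (hlim : ∀ x, Tendsto (fun N => (c N x : ℝ) / N) atTop (𝓝 (p x))) :
    Tendsto (fun N => Real.log (bayesMeasure a (c N)) / N) atTop
      (𝓝 (∑ x, p x * Real.log (p x))) := by
  obtain ⟨C, hC⟩ := exists_abs_log_bayesMeasure_sub_le ha
  set K : ℝ := ∑ x, |a x - 1 / 2| + |∑ x, a x - 1 / 2| with hK
  have hb : ∀ N, |Real.log (bayesMeasure a (c N)) / N - logLik (c N) / N| ≤
      C / N + K * (Real.log N / N) := by
    intro N
    rw [← sub_div, abs_div, Nat.abs_cast, ← mul_div_assoc, ← add_div]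
    refine div_le_div_of_nonneg_right ?_ (Nat.cast_nonneg N)
    have h1 := hC (c N)
    rw [hc] at h1
    have hcle : ∀ x, c N x ≤ N := fun x => by
      conv_rhs => rw [← hc N]
      exact Finset.single_le_sum (f := c N) (fun _ _ => Nat.zero_le _) (Finset.mem_univ x)
    have h2 : |∑ x, (a x - 1 / 2) * Real.log (c N x)| ≤ (∑ x, |a x - 1 / 2|) * Real.log N := by
      rw [Finset.sum_mul]
      refine (Finset.abs_sum_le_sum_abs _ _).trans (Finset.sum_le_sum fun x _ => ?_)
      rw [abs_mul, abs_of_nonneg (Real.log_natCast_nonneg _)]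
      refine mul_le_mul_of_nonneg_left ?_ (abs_nonneg _)
      rcases Nat.eq_zero_or_pos (c N x) with h0 | h0
      · simpa [h0] using Real.log_natCast_nonneg N
      · exact Real.log_le_log (by exact_mod_cast h0) (by exact_mod_cast hcle x)
    have h3 : |(∑ x, a x - 1 / 2) * Real.log N| = |∑ x, a x - 1 / 2| * Real.log N := by
      rw [abs_mul, abs_of_nonneg (Real.log_natCast_nonneg _)]
    have h4 := neg_abs_le ((∑ x, a x - 1 / 2) * Real.log N)
    have h5 := le_abs_self ((∑ x, a x - 1 / 2) * Real.log N)
    rw [h3] at h4 h5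
    rw [hK, add_mul]
    rw [abs_le] at h1 h2 ⊢
    constructor <;> linarith [h1.1, h1.2, h2.1, h2.2]
  have hz : Tendsto (fun N : ℕ => C / N + K * (Real.log N / N)) atTop (𝓝 0) := by
    simpa using (tendsto_const_div_atTop_nhds_zero_nat C).add
      (tendsto_log_natCast_div_natCast.const_mul K)
  have h := (squeeze_zero_norm hb hz).add (tendsto_logLik_div hc hlim)
  simpa using h

/-- The two alternative assumptions take effect here: either `log (c N x)` is `log N` up to a
convergent term, or its coefficient vanishes. -/
theorem exists_tendsto_sum_mul_log_sub_log {a : A → ℝ}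
    (hlim : ∀ x, Tendsto (fun N => (c N x : ℝ) / N) atTop (𝓝 (p x)))
    (h : (∀ x, 0 < p x) ∨ ∀ x, a x = 1 / 2) :
    ∃ L, Tendsto (fun N : ℕ => ∑ x, (a x - 1 / 2) * (Real.log (c N x) - Real.log N)) atTop
      (𝓝 L) := by
  rcases h with h | h
  · refine ⟨∑ x, (a x - 1 / 2) * Real.log (p x), tendsto_finsetSum _ fun x _ =>
      Tendsto.const_mul _ (((hlim x).log (h x).ne').congr' ?_)⟩
    filter_upwards [eventually_gt_atTop 0, (hlim x).eventually_ne (h x).ne'] with N hN h0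
    exact Real.log_div (fun h' => h0 (by rw [h', zero_div])) (by positivity)
  · exact ⟨0, by simp [h]⟩

/-- The Bayes measure pays half the logarithm of the sample size for each free parameter. -/
theorem exists_eventually_abs_log_bayesMeasure_sub_le [Nonempty A] {a : A → ℝ}
    (ha : ∀ x, 0 < a x) (hc : ∀ N, ∑ x, c N x = N)
    (hlim : ∀ x, Tendsto (fun N => (c N x : ℝ) / N) atTop (𝓝 (p x)))
    (h : (∀ x, 0 < p x) ∨ ∀ x, a x = 1 / 2) :
    ∃ C, ∀ᶠ N : ℕ in atTop, |Real.log (bayesMeasure a (c N)) -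
      (logLik (c N) - ((Fintype.card A : ℝ) - 1) / 2 * Real.log N)| ≤ C := by
  obtain ⟨C, hC⟩ := exists_abs_log_bayesMeasure_sub_le ha
  obtain ⟨L, hL⟩ := exists_tendsto_sum_mul_log_sub_log hlim h
  refine ⟨C + (|L| + 1), ?_⟩
  filter_upwards [hL.abs.eventually_le_const (lt_add_one |L|)] with N hN
  have h1 := hC (c N)
  rw [hc] at h1
  -- Replacing each `log (c N x)` by `log N` leaves the coefficient `(∑ a - |A| / 2) - (∑ a - 1 / 2)
  -- = -(|A| - 1) / 2`, free of the parameters.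
  have e : ∑ x, (a x - 1 / 2) * (Real.log (c N x) - Real.log N) =
      ∑ x, (a x - 1 / 2) * Real.log (c N x) -
        (∑ x, a x - Fintype.card A / 2) * Real.log N := by
    simp only [mul_sub, Finset.sum_sub_distrib, ← Finset.sum_mul]
    simp [div_eq_mul_inv]
  rw [e] at hN
  rw [abs_le] at h1 hN ⊢
  constructor <;> linarith [h1.1, h1.2, hN.1, hN.2]

end Single

/-! ### The Bayes ratio along typical counts. -/

section Joint

variable {A B : Type*} [Fintype A] [Fintype B]

/-- The logarithm of the ratio of the Bayes measures of the pairs and of the marginals. -/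
noncomputable def logRatio (a₁ : A → ℝ) (a₂ : B → ℝ) (b : A × B → ℝ) (c : A × B → ℕ) : ℝ :=
  Real.log (bayesMeasure b c /
    (bayesMeasure a₁ (fun x => ∑ y, c (x, y)) * bayesMeasure a₂ (fun y => ∑ x, c (x, y))))

theorem logRatio_eq_sub [Nonempty A] [Nonempty B] {a₁ : A → ℝ} {a₂ : B → ℝ} {b : A × B → ℝ}
    (ha₁ : ∀ x, 0 < a₁ x) (ha₂ : ∀ y, 0 < a₂ y) (hb : ∀ z, 0 < b z) (c : A × B → ℕ) :
    logRatio a₁ a₂ b c = Real.log (bayesMeasure b c) -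
      Real.log (bayesMeasure a₁ (fun x => ∑ y, c (x, y))) -
      Real.log (bayesMeasure a₂ (fun y => ∑ x, c (x, y))) := by
  have h1 := (bayesMeasure_pos ha₁ (fun x => ∑ y, c (x, y))).ne'
  have h2 := (bayesMeasure_pos ha₂ (fun y => ∑ x, c (x, y))).ne'
  rw [logRatio, Real.log_div (bayesMeasure_pos hb c).ne' (mul_ne_zero h1 h2), Real.log_mul h1 h2]
  ring

/-- The counts `c N` of samples of size `N` deviate from their expectations `N * p` by at most
`o(√(N log N))`. -/
structure IsTypicalCounts {A : Type*} [Fintype A] (p : A → ℝ) (c : ℕ → A → ℕ) : Prop where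
  sum_eq : ∀ N, ∑ z, c N z = N
  eq_zero : ∀ z, p z = 0 → ∀ N, c N z = 0
  sq_le : ∀ z, ∀ δ > 0, ∀ᶠ N : ℕ in atTop, ((c N z : ℝ) - N * p z) ^ 2 ≤ δ * (N * Real.log N)

theorem IsTypicalCounts.tendsto_div {p : A → ℝ} {c : ℕ → A → ℕ} (h : IsTypicalCounts p c) (z : A) :
    Tendsto (fun N => (c N z : ℝ) / N) atTop (𝓝 (p z)) := by
  have h1 : Tendsto (fun N => ((c N z : ℝ) / N - p z) ^ 2) atTop (𝓝 0) := by
    refine tendsto_of_tendsto_of_tendsto_of_le_of_le' tendsto_const_nhds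
      tendsto_log_natCast_div_natCast (Eventually.of_forall fun N => sq_nonneg _) ?_
    filter_upwards [h.sq_le z 1 one_pos, eventually_gt_atTop 0] with N h1 hN
    have hN0 : (0 : ℝ) < N := by exact_mod_cast hN
    have e : ((c N z : ℝ) / N - p z) ^ 2 = ((c N z : ℝ) - N * p z) ^ 2 / (N * N) := by
      field_simp
    rw [e, div_le_iff₀ (by positivity)]
    refine h1.trans (le_of_eq ?_)
    field_simp
  have h2 : Tendsto (fun N => (c N z : ℝ) / N - p z) atTop (𝓝 0) := by
    have h3 := h1.sqrt
    simp only [Real.sqrt_sq_eq_abs, Real.sqrt_zero] at h3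
    exact (tendsto_zero_iff_abs_tendsto_zero _).2 h3
  simpa using h2.add_const (p z)

variable {p : A × B → ℝ} {c : ℕ → A × B → ℕ}

theorem IsTypicalCounts.tendsto_fst_div (h : IsTypicalCounts p c) (x : A) :
    Tendsto (fun N => ((∑ y, c N (x, y) : ℕ) : ℝ) / N) atTop (𝓝 (∑ y, p (x, y))) := by
  simp only [Nat.cast_sum, Finset.sum_div]
  exact tendsto_finsetSum _ fun y _ => h.tendsto_div (x, y)

theorem IsTypicalCounts.tendsto_snd_div (h : IsTypicalCounts p c) (y : B) :
    Tendsto (fun N => ((∑ x, c N (x, y) : ℕ) : ℝ) / N) atTop (𝓝 (∑ x, p (x, y))) := by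
  simp only [Nat.cast_sum, Finset.sum_div]
  exact tendsto_finsetSum _ fun x _ => h.tendsto_div (x, y)

theorem IsTypicalCounts.sum_fst (h : IsTypicalCounts p c) (N : ℕ) :
    ∑ x, ∑ y, c N (x, y) = N := by
  rw [← Fintype.sum_prod_type, h.sum_eq]

theorem IsTypicalCounts.sum_snd (h : IsTypicalCounts p c) (N : ℕ) :
    ∑ y, ∑ x, c N (x, y) = N := by
  rw [← Fintype.sum_prod_type_right, h.sum_eq]

theorem IsTypicalCounts.tendsto_logRatio_div [Nonempty A] [Nonempty B] (h : IsTypicalCounts p c)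
    (hp : ∀ z, 0 ≤ p z) {a₁ : A → ℝ} {a₂ : B → ℝ} {b : A × B → ℝ}
    (ha₁ : ∀ x, 0 < a₁ x) (ha₂ : ∀ y, 0 < a₂ y) (hb : ∀ z, 0 < b z) :
    Tendsto (fun N => logRatio a₁ a₂ b (c N) / N) atTop (𝓝 (pmfMutualInfo p)) := by
  rw [pmfMutualInfo_eq_entropies hp]
  simp only [logRatio_eq_sub ha₁ ha₂ hb, sub_div]
  exact ((tendsto_log_bayesMeasure_div hb h.sum_eq h.tendsto_div).sub
    (tendsto_log_bayesMeasure_div ha₁ h.sum_fst h.tendsto_fst_div)).sub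
    (tendsto_log_bayesMeasure_div ha₂ h.sum_snd h.tendsto_snd_div)

theorem IsTypicalCounts.eventually_empMutualInfo_le (h : IsTypicalCounts p c)
    (hp : ∀ z, 0 ≤ p z) (hsum : ∑ z, p z = 1)
    (hind : ∀ z : A × B, p z = (∑ y', p (z.1, y')) * ∑ x', p (x', z.2)) {ε : ℝ} (hε : 0 < ε) :
    ∀ᶠ N : ℕ in atTop, empMutualInfo (c N) ≤ ε * Real.log N := by
  have hS : 0 ≤ ∑ z, (p z)⁻¹ := Finset.sum_nonneg fun z _ => inv_nonneg.2 (hp z)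
  -- Chi-square is at most `δ log N` times the sum of the inverses. The `+ 1` keeps the denominator
  -- positive; cells with `p z = 0` contribute 0, since division by zero gives 0.
  set δ : ℝ := ε / (∑ z, (p z)⁻¹ + 1) with hδ
  have hδ0 : 0 < δ := by positivity
  filter_upwards [eventually_all.2 fun z => h.sq_le z δ hδ0, eventually_gt_atTop 0] with N h1 hN
  have hN0 : (0 : ℝ) < N := by exact_mod_cast hN
  have hl : 0 ≤ Real.log N := Real.log_natCast_nonneg N
  refine (empMutualInfo_le_chi_sq hp hsum hind fun z hz => h.eq_zero z hz N).trans ?_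
  rw [h.sum_eq]
  calc ∑ z, ((c N z : ℝ) - N * p z) ^ 2 / (N * p z)
      ≤ ∑ z, δ * Real.log N * (p z)⁻¹ := by
        refine Finset.sum_le_sum fun z _ => ?_
        refine (div_le_div_of_nonneg_right (h1 z) (mul_nonneg hN0.le (hp z))).trans (le_of_eq ?_)
        rw [mul_left_comm, mul_div_mul_left _ _ hN0.ne', div_eq_mul_inv]
    _ = δ * (∑ z, (p z)⁻¹) * Real.log N := by rw [← Finset.mul_sum]; ring
    _ ≤ ε * Real.log N := by
        refine mul_le_mul_of_nonneg_right ?_ hl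
        calc δ * ∑ z, (p z)⁻¹ ≤ δ * (∑ z, (p z)⁻¹ + 1) :=
              mul_le_mul_of_nonneg_left (by linarith) hδ0.le
          _ = ε := div_mul_cancel₀ _ (by positivity)

theorem IsTypicalCounts.eventually_logRatio_nonpos (h : IsTypicalCounts p c)
    (hp : ∀ z, 0 ≤ p z) (hsum : ∑ z, p z = 1)
    (hind : ∀ z : A × B, p z = (∑ y', p (z.1, y')) * ∑ x', p (x', z.2))
    (hA : 2 ≤ Fintype.card A) (hB : 2 ≤ Fintype.card B)
    {a₁ : A → ℝ} {a₂ : B → ℝ} {b : A × B → ℝ}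
    (ha₁ : ∀ x, 0 < a₁ x) (ha₂ : ∀ y, 0 < a₂ y) (hb : ∀ z, 0 < b z)
    (hsupp : ((∀ x, 0 < ∑ y, p (x, y)) ∧ ∀ y, 0 < ∑ x, p (x, y)) ∨
      (∀ x, a₁ x = 1 / 2) ∧ (∀ y, a₂ y = 1 / 2) ∧ ∀ z, b z = 1 / 2) :
    ∀ᶠ N : ℕ in atTop, logRatio a₁ a₂ b (c N) ≤ 0 := by
  have : Nonempty A := Fintype.card_pos_iff.1 (by lia)
  have : Nonempty B := Fintype.card_pos_iff.1 (by lia)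
  obtain ⟨C₁, h1⟩ := exists_eventually_abs_log_bayesMeasure_sub_le ha₁ h.sum_fst
    h.tendsto_fst_div (hsupp.imp (·.1) (·.1))
  obtain ⟨C₂, h2⟩ := exists_eventually_abs_log_bayesMeasure_sub_le ha₂ h.sum_snd
    h.tendsto_snd_div (hsupp.imp (·.2) (·.2.1))
  obtain ⟨C, h3⟩ := exists_eventually_abs_log_bayesMeasure_sub_le hb h.sum_eq
    h.tendsto_div (hsupp.imp (fun h z => by rw [hind z]; exact mul_pos (h.1 _) (h.2 _)) (·.2.2))
  have hlog : Tendsto (fun N : ℕ => Real.log N) atTop atTop :=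
    Real.tendsto_log_atTop.comp tendsto_natCast_atTop_atTop
  -- The penalty is at least `(1/2) log N`. Half of it pays for the empirical information, the other
  -- half for the three constants, whence the threshold in `log N`.
  filter_upwards [h1, h2, h3, h.eventually_empMutualInfo_le hp hsum hind (ε := 1 / 4) (by norm_num),
    hlog.eventually_ge_atTop (4 * (C₁ + C₂ + C))] with N h1 h2 h3 h4 h5
  have hl : 0 ≤ Real.log N := Real.log_natCast_nonneg N
  have hA' : (2 : ℝ) ≤ Fintype.card A := by exact_mod_cast hA
  have hB' : (2 : ℝ) ≤ Fintype.card B := by exact_mod_cast hB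
  have h6 : 1 * Real.log N ≤ ((Fintype.card A : ℝ) - 1) * (Fintype.card B - 1) * Real.log N :=
    mul_le_mul_of_nonneg_right (by nlinarith) hl
  rw [logRatio_eq_sub ha₁ ha₂ hb]
  rw [empMutualInfo] at h4
  rw [Fintype.card_prod, Nat.cast_mul] at h3
  rw [abs_le] at h1 h2 h3
  linarith [h1.1, h2.1, h3.2]

theorem IsTypicalCounts.eventually_logRatio_nonpos_iff (h : IsTypicalCounts p c)
    (hp : ∀ z, 0 ≤ p z) (hsum : ∑ z, p z = 1)
    (hA : 2 ≤ Fintype.card A) (hB : 2 ≤ Fintype.card B)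
    {a₁ : A → ℝ} {a₂ : B → ℝ} {b : A × B → ℝ}
    (ha₁ : ∀ x, 0 < a₁ x) (ha₂ : ∀ y, 0 < a₂ y) (hb : ∀ z, 0 < b z)
    (hsupp : ((∀ x, 0 < ∑ y, p (x, y)) ∧ ∀ y, 0 < ∑ x, p (x, y)) ∨
      (∀ x, a₁ x = 1 / 2) ∧ (∀ y, a₂ y = 1 / 2) ∧ ∀ z, b z = 1 / 2) :
    ∀ᶠ N : ℕ in atTop, (logRatio a₁ a₂ b (c N) ≤ 0 ↔ pmfMutualInfo p = 0) := by
  rcases (pmfMutualInfo_nonneg hp hsum).eq_or_lt with h0 | h0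
  · filter_upwards [h.eventually_logRatio_nonpos hp hsum
      (eq_marginal_mul_of_pmfMutualInfo_eq_zero hp hsum h0.symm) hA hB ha₁ ha₂ hb hsupp] with N hN
    exact iff_of_true hN h0.symm
  · have : Nonempty A := Fintype.card_pos_iff.1 (by lia)
    have : Nonempty B := Fintype.card_pos_iff.1 (by lia)
    filter_upwards [(h.tendsto_logRatio_div hp ha₁ ha₂ hb).eventually_const_lt h0] with N hN
    refine iff_of_false (fun h' => hN.not_ge ?_) h0.ne'
    exact div_nonpos_of_nonpos_of_nonneg h' (Nat.cast_nonneg N)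

end Joint

/-! ### Almost sure bounds for sums of independent sub-Gaussian variables -/

section SubGaussian

variable {Ω : Type*} [MeasurableSpace Ω] {P : Measure Ω} [IsProbabilityMeasure P] {ξ : ℕ → Ω → ℝ}

/-- The next factor is independent of the past and has mean at least 1, because `exp u ≥ 1 + u` and
the variables are centred. The sum runs through index `n` to match the natural filtration at `n`. -/
theorem submartingale_exp_mul_sum (hmeas : ∀ k, Measurable (ξ k)) (hindep : iIndepFun ξ P)
    {c : ℝ≥0} (hsub : ∀ k, HasSubgaussianMGF (ξ k) c P) (hmean : ∀ k, ∫ ω, ξ k ω ∂P = 0) (t : ℝ) :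
    Submartingale (fun n ω => Real.exp (t * ∑ k ∈ Finset.range (n + 1), ξ k ω))
      (Filtration.natural ξ fun k => (hmeas k).stronglyMeasurable) P := by
  set 𝒢 := Filtration.natural ξ fun k => (hmeas k).stronglyMeasurable with h𝒢
  have hint : ∀ n, Integrable (fun ω => Real.exp (t * ∑ k ∈ Finset.range n, ξ k ω)) P := fun n =>
    (HasSubgaussianMGF.sum_of_iIndepFun hindep (s := Finset.range n)
      fun k _ => hsub k).integrable_exp_mul t
  have hadp : StronglyAdapted 𝒢 fun n ω => Real.exp (t * ∑ k ∈ Finset.range (n + 1), ξ k ω) := by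
    intro n
    have h1 : ∀ k ∈ Finset.range (n + 1), Measurable[𝒢 n] (ξ k) := fun k hk =>
      ((Filtration.stronglyAdapted_natural fun k => (hmeas k).stronglyMeasurable) k).measurable.mono
        (𝒢.mono (Nat.lt_succ_iff.1 (Finset.mem_range.1 hk))) le_rfl
    exact (Real.measurable_exp.comp
      ((Finset.measurable_fun_sum _ h1).const_mul t)).stronglyMeasurable
  refine submartingale_nat hadp (fun n => hint (n + 1)) fun n => ?_
  have hf : (fun ω => Real.exp (t * ∑ k ∈ Finset.range (n + 1 + 1), ξ k ω)) =
      (fun ω => Real.exp (t * ∑ k ∈ Finset.range (n + 1), ξ k ω)) *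
        fun ω => Real.exp (t * ξ (n + 1) ω) := by
    funext ω
    rw [Pi.mul_apply, ← Real.exp_add, ← mul_add, ← Finset.sum_range_succ]
  have h1 := condExp_mul_of_stronglyMeasurable_left (m := 𝒢 n) (hadp n) (hf ▸ hint (n + 1 + 1))
    ((hsub (n + 1)).integrable_exp_mul t)
  have h2 : P[fun ω => Real.exp (t * ξ (n + 1) ω) | 𝒢 n] =ᵐ[P]
      fun _ => ∫ ω, Real.exp (t * ξ (n + 1) ω) ∂P :=
    condExp_indep_eq (hmeas (n + 1)).comap_le (𝒢.le n)
      (Real.measurable_exp.comp ((comap_measurable (ξ (n + 1))).const_mul t)).stronglyMeasurable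
      (iIndepFun.indep_comap_natural_of_lt _ hindep (Nat.lt_succ_self n))
  have h3 : 1 ≤ ∫ ω, Real.exp (t * ξ (n + 1) ω) ∂P := by
    have hi : Integrable (fun ω => t * ξ (n + 1) ω) P := (hsub (n + 1)).integrable.const_mul t
    calc (1 : ℝ) = ∫ ω, (t * ξ (n + 1) ω + 1) ∂P := by
          rw [integral_add hi (integrable_const 1), integral_const_mul, hmean]
          simp
      _ ≤ _ := integral_mono (hi.add (integrable_const 1))
          ((hsub (n + 1)).integrable_exp_mul t) fun ω => Real.add_one_le_exp _
  simp only [hf]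
  filter_upwards [h1, h2] with ω e1 e2
  rw [e1, Pi.mul_apply, e2]
  exact le_mul_of_one_le_right (Real.exp_pos _).le h3

/-- Doob's maximal inequality, with the final expectation bounded by the sub-Gaussian moment
generating function. -/
theorem measure_exists_le_exp_mul_sum_le (hmeas : ∀ k, Measurable (ξ k)) (hindep : iIndepFun ξ P)
    {c : ℝ≥0} (hsub : ∀ k, HasSubgaussianMGF (ξ k) c P) (hmean : ∀ k, ∫ ω, ξ k ω ∂P = 0) (t : ℝ)
    {r : ℝ≥0} (hr : 0 < r) (n : ℕ) :
    P {ω | ∃ m ≤ n, (r : ℝ) ≤ Real.exp (t * ∑ k ∈ Finset.range (m + 1), ξ k ω)} ≤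
      ENNReal.ofReal (Real.exp ((n + 1) * c * t ^ 2 / 2) / r) := by
  have hM := submartingale_exp_mul_sum hmeas hindep hsub hmean t
  have h1 := maximal_ineq hM (fun n ω => (Real.exp_pos _).le) (ε := r) n
  have hset : {ω | ∃ m ≤ n, (r : ℝ) ≤ Real.exp (t * ∑ k ∈ Finset.range (m + 1), ξ k ω)} =
      {ω | (r : ℝ) ≤ (Finset.range (n + 1)).sup' Finset.nonempty_range_add_one
        fun m => Real.exp (t * ∑ k ∈ Finset.range (m + 1), ξ k ω)} := by
    ext ω
    simp [Finset.le_sup'_iff]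
  rw [← hset] at h1
  have h2 := (HasSubgaussianMGF.sum_of_iIndepFun hindep (s := Finset.range (n + 1))
      fun k _ => hsub k).mgf_le t
  have h3 : ∫ ω in {ω | ∃ m ≤ n, (r : ℝ) ≤ Real.exp (t * ∑ k ∈ Finset.range (m + 1), ξ k ω)},
      Real.exp (t * ∑ k ∈ Finset.range (n + 1), ξ k ω) ∂P ≤
        Real.exp ((n + 1) * c * t ^ 2 / 2) := by
    refine (setIntegral_le_integral (hM.integrable n)
      (ae_of_all _ fun ω => (Real.exp_pos _).le)).trans (h2.trans (le_of_eq ?_))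
    simp
  have hr' : (r : ℝ≥0∞) ≠ 0 := by exact_mod_cast hr.ne'
  rw [ENNReal.ofReal_div_of_pos (by exact_mod_cast hr), ENNReal.ofReal_coe_nnreal,
    ENNReal.le_div_iff_mul_le (Or.inl hr') (Or.inl ENNReal.coe_ne_top), mul_comm]
  exact h1.trans (ENNReal.ofReal_le_ofReal h3)

/-- A weak form of the upper half of the law of the iterated logarithm. -/
theorem ae_eventually_sum_lt (hmeas : ∀ k, Measurable (ξ k)) (hindep : iIndepFun ξ P)
    {c : ℝ≥0} (hsub : ∀ k, HasSubgaussianMGF (ξ k) c P) (hmean : ∀ k, ∫ ω, ξ k ω ∂P = 0) :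
    ∀ᵐ ω ∂P, ∀ᶠ N : ℕ in atTop,
      ∑ k ∈ Finset.range N, ξ k ω < 2 * Real.log (Nat.log 2 N + 1) * √N := by
  -- Dyadic blocks: for sums of length at most `2 ^ (j + 1)`, take `t = 2 ^ (-j / 2)` and the level
  -- `(j + 1) ^ 2`. The exponent in the maximal bound is then exactly `c`, so the probabilities are
  -- at most `exp c / (j + 1) ^ 2` and Borel–Cantelli applies. Taking logarithms of the level gives
  -- `2 log (j + 1)`.
  have hfin : ∑' j : ℕ, P {ω | ∃ m ≤ 2 ^ (j + 1) - 1, ((((j : ℝ≥0) + 1) ^ 2 : ℝ≥0) : ℝ) ≤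
      Real.exp ((√(2 ^ j))⁻¹ * ∑ k ∈ Finset.range (m + 1), ξ k ω)} ≠ ∞ := by
    have hs : Summable fun j : ℕ => Real.exp c / ((j : ℝ) + 1) ^ 2 := by
      have h := (summable_nat_add_iff 1).2 (Real.summable_nat_pow_inv.2 one_lt_two)
      simpa [div_eq_mul_inv] using h.mul_left (Real.exp c)
    refine ne_top_of_le_ne_top hs.tsum_ofReal_ne_top (ENNReal.tsum_le_tsum fun j => ?_)
    refine (measure_exists_le_exp_mul_sum_le hmeas hindep hsub hmean _ (by positivity) _).trans
      (le_of_eq ?_)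
    have h1 : (((2 ^ (j + 1) - 1 : ℕ) : ℝ) + 1) = 2 * 2 ^ j := by
      rw [Nat.cast_sub Nat.one_le_two_pow]
      push_cast
      ring
    rw [h1, inv_pow, Real.sq_sqrt (by positivity)]
    have h2 : (2 * 2 ^ j * c * ((2 : ℝ) ^ j)⁻¹ / 2 : ℝ) = c := by field_simp
    rw [h2]
    push_cast
    rfl
  filter_upwards [ae_eventually_notMem hfin] with ω hω
  have hlog : Tendsto (Nat.log 2) atTop atTop :=
    tendsto_atTop_atTop.2 fun b => ⟨2 ^ b, fun N hN => Nat.le_log_of_pow_le one_lt_two hN⟩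
  filter_upwards [hlog.eventually hω, eventually_gt_atTop 0] with N hN h0
  set j := Nat.log 2 N with hj
  have hlow : 2 ^ j ≤ N := Nat.pow_log_le_self 2 h0.ne'
  have hhigh : N < 2 ^ (j + 1) := Nat.lt_pow_succ_log_self one_lt_two N
  simp only [not_exists, not_and, not_le] at hN
  have h1 := hN (N - 1) (by lia)
  rw [Nat.sub_add_cancel h0] at h1
  have h2 := (Real.lt_log_iff_exp_lt (by positivity)).2 h1
  push_cast at h2
  rw [Real.log_pow, inv_mul_lt_iff₀ (by positivity), mul_comm] at h2
  refine h2.trans_le ?_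
  have h3 : 0 ≤ Real.log ((j : ℝ) + 1) := Real.log_nonneg (by linarith [j.cast_nonneg (α := ℝ)])
  push_cast
  refine mul_le_mul_of_nonneg_left (Real.sqrt_le_sqrt ?_) (by positivity)
  exact_mod_cast hlow

theorem eventually_sq_mul_log_log_le {δ : ℝ} (hδ : 0 < δ) :
    ∀ᶠ N : ℕ in atTop, (2 * Real.log (Nat.log 2 N + 1) * √N) ^ 2 ≤ δ * (N * Real.log N) := by
  have hlog : Tendsto (fun N : ℕ => ((Nat.log 2 N : ℕ) : ℝ) + 1) atTop atTop :=
    tendsto_atTop_add_const_right _ _ (tendsto_natCast_atTop_atTop.comp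
      (tendsto_atTop_atTop.2 fun b => ⟨2 ^ b, fun N hN => Nat.le_log_of_pow_le one_lt_two hN⟩))
  -- The 8 absorbs the 4 from squaring `2 log (j + 1)` and the 2 from `j + 1 ≤ 2 j`; `log 2` comes
  -- from `j log 2 ≤ log N`.
  have h2 : 0 < δ * Real.log 2 / 8 := by have := Real.log_pos one_lt_two; positivity
  have h := hlog.eventually ((Real.isLittleO_pow_log_id_atTop (n := 2)).def h2)
  filter_upwards [h, eventually_ge_atTop 2] with N hN h0
  set j := Nat.log 2 N with hj
  have hlow : 2 ^ j ≤ N := Nat.pow_log_le_self 2 (by lia)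
  have hj1 : 1 ≤ j := Nat.le_log_of_pow_le one_lt_two (by simpa using h0)
  have hj1' : (1 : ℝ) ≤ j := by exact_mod_cast hj1
  have h3 : j * Real.log 2 ≤ Real.log N := by
    rw [← Real.log_pow]
    exact Real.log_le_log (by positivity) (by exact_mod_cast hlow)
  simp only [id, Real.norm_eq_abs, abs_pow, sq_abs] at hN
  rw [abs_of_nonneg (by positivity)] at hN
  have h4 : Real.log ((j : ℝ) + 1) ^ 2 * 4 ≤ δ * Real.log N := by
    calc _ ≤ δ * Real.log 2 / 8 * (j + 1) * 4 := by linarith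
      _ ≤ δ * Real.log 2 / 8 * (2 * j) * 4 := by gcongr; linarith
      _ = δ * (j * Real.log 2) := by ring
      _ ≤ _ := by gcongr
  rw [mul_pow, Real.sq_sqrt (Nat.cast_nonneg N), mul_pow]
  calc _ = (Real.log ((j : ℝ) + 1) ^ 2 * 4) * N := by ring
    _ ≤ δ * Real.log N * N := by gcongr
    _ = _ := by ring

theorem ae_eventually_sq_sum_le (hmeas : ∀ k, Measurable (ξ k)) (hindep : iIndepFun ξ P)
    {c : ℝ≥0} (hsub : ∀ k, HasSubgaussianMGF (ξ k) c P) (hmean : ∀ k, ∫ ω, ξ k ω ∂P = 0) :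
    ∀ᵐ ω ∂P, ∀ δ > 0, ∀ᶠ N : ℕ in atTop,
      (∑ k ∈ Finset.range N, ξ k ω) ^ 2 ≤ δ * (N * Real.log N) := by
  have hneg : iIndepFun (fun k => -ξ k) P := hindep.comp (fun _ x => -x) fun _ => measurable_neg
  filter_upwards [ae_eventually_sum_lt hmeas hindep hsub hmean,
    ae_eventually_sum_lt (fun k => (hmeas k).neg) hneg (fun k => (hsub k).neg)
      (fun k => by simp [integral_neg, hmean])] with ω h1 h2 δ hδ
  filter_upwards [h1, h2, eventually_sq_mul_log_log_le hδ] with N h1 h2 h3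
  refine (sq_le_sq.2 ?_).trans h3
  simp only [Pi.neg_apply, Finset.sum_neg_distrib] at h2
  exact (abs_le.2 ⟨by linarith, h1.le⟩).trans (le_abs_self _)

end SubGaussian

/-! ### Counts of independent samples -/

/-- The number of indices `k < N` such that `x k = z`. -/
def seqCount {A : Type*} [DecidableEq A] (x : ℕ → A) (N : ℕ) (z : A) : ℕ :=
  ((Finset.range N).filter fun k => x k = z).card

/-- Centred indicators are bounded, hence sub-Gaussian by Hoeffding's lemma, and the almost sure
bound above applies to each value. Values of probability zero almost surely never occur. -/
theorem ae_isTypicalCounts {Ω A : Type*} [MeasurableSpace Ω] {P : Measure Ω}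
    [IsProbabilityMeasure P] [Fintype A] [DecidableEq A] [MeasurableSpace A]
    [MeasurableSingletonClass A] {Z : ℕ → Ω → A} (hmeas : ∀ k, Measurable (Z k))
    (hindep : iIndepFun Z P) {p : A → ℝ} (hp : ∀ k z, P.real {ω | Z k ω = z} = p z) :
    ∀ᵐ ω ∂P, IsTypicalCounts p (seqCount fun k => Z k ω) := by
  have hzero : ∀ᵐ ω ∂P, ∀ z, p z = 0 → ∀ k, Z k ω ≠ z := by
    simp only [ae_all_iff]
    intro z hz k
    have h := hp k z
    rw [hz, measureReal_eq_zero_iff] at h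
    simpa [ae_iff] using h
  have hset : ∀ k z, MeasurableSet {ω | Z k ω = z} := fun k z =>
    hmeas k (measurableSet_singleton z)
  have hdev : ∀ z, ∀ᵐ ω ∂P, ∀ δ > 0, ∀ᶠ N : ℕ in atTop,
      (∑ k ∈ Finset.range N, ((if Z k ω = z then 1 else 0) - p z)) ^ 2 ≤
        δ * (N * Real.log N) := by
    intro z
    have hg : Measurable fun w : A => ((if w = z then 1 else 0) : ℝ) - p z := measurable_of_finite _
    have hint : ∀ k, ∫ ω, (if Z k ω = z then (1 : ℝ) else 0) ∂P = p z := fun k => by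
      have e : (fun ω => if Z k ω = z then (1 : ℝ) else 0) =
          Set.indicator {ω | Z k ω = z} fun _ => 1 := by
        funext ω
        simp [Set.indicator_apply]
      rw [e, integral_indicator_const _ (hset k z), hp, smul_eq_mul, mul_one]
    have hsub : ∀ k, HasSubgaussianMGF (fun ω => (if Z k ω = z then (1 : ℝ) else 0) - p z)
        ((‖(1 : ℝ) - 0‖₊ / 2) ^ 2) P := fun k => by
      rw [← hint k]
      refine hasSubgaussianMGF_of_mem_Icc ?_ (ae_of_all _ fun ω => ?_)
      · exact ((measurable_of_finite fun w : A => if w = z then (1 : ℝ) else 0).comp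
          (hmeas k)).aemeasurable
      · split_ifs <;> simp
    refine ae_eventually_sq_sum_le (fun k => hg.comp (hmeas k)) (hindep.comp _ fun _ => hg) hsub
      fun k => ?_
    have h1 : Integrable (fun ω => if Z k ω = z then (1 : ℝ) else 0) P :=
      ((hsub k).integrable.add (integrable_const (p z))).congr (ae_of_all _ fun ω => by simp)
    change ∫ ω, ((if Z k ω = z then (1 : ℝ) else 0) - p z) ∂P = 0
    rw [integral_sub h1 (integrable_const _), hint]
    simp
  filter_upwards [hzero, ae_all_iff.2 hdev] with ω h1 h2
  refine ⟨fun N => ?_, fun z hz N => ?_, fun z δ hδ => ?_⟩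
  · have h := Finset.card_eq_sum_card_fiberwise (f := fun k => Z k ω) (s := Finset.range N)
      (t := Finset.univ) fun _ _ => Finset.mem_coe.2 (Finset.mem_univ _)
    rw [Finset.card_range] at h
    exact h.symm
  · exact Finset.card_eq_zero.2 (Finset.filter_false_of_mem fun k _ => h1 z hz k)
  · filter_upwards [h2 z δ hδ] with N hN
    rw [Finset.sum_sub_distrib, Finset.sum_boole, Finset.sum_const, Finset.card_range,
      nsmul_eq_mul] at hN
    exact hN

/-! ### Mutual information of random variables -/

section MutualInfo

variable {Ω A B : Type*} [MeasurableSpace Ω] {P : Measure Ω} [IsProbabilityMeasure P]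
  [MeasurableSpace A] [MeasurableSpace B] [MeasurableSingletonClass A]
  [MeasurableSingletonClass B] {U : Ω → A} {V : Ω → B}

theorem measureReal_eq_sum_snd [Fintype B] (hU : Measurable U) (hV : Measurable V) (x : A) :
    P.real {ω | U ω = x} = ∑ y, P.real {ω | U ω = x ∧ V ω = y} := by
  rw [← measureReal_biUnion_finset]
  · congr 1
    ext ω
    simp
  · intro y _ y' _ hne
    refine Set.disjoint_left.2 fun ω h h' => hne ?_
    exact h.2.symm.trans h'.2
  · exact fun y _ => (hU (measurableSet_singleton x)).inter (hV (measurableSet_singleton y))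

theorem measureReal_eq_sum_fst [Fintype A] (hU : Measurable U) (hV : Measurable V) (y : B) :
    P.real {ω | V ω = y} = ∑ x, P.real {ω | U ω = x ∧ V ω = y} := by
  simp only [measureReal_eq_sum_snd hV hU y, and_comm]

variable [Fintype A] [Fintype B]

theorem mutualInfo_eq_pmfMutualInfo (hU : Measurable U) (hV : Measurable V) :
    mutualInfo P U V = pmfMutualInfo fun z : A × B => P.real {ω | U ω = z.1 ∧ V ω = z.2} := by
  simp only [mutualInfo, pmfMutualInfo, measureReal_eq_sum_snd hU hV,
    measureReal_eq_sum_fst hU hV]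

theorem sum_measureReal_pair (hU : Measurable U) (hV : Measurable V) :
    ∑ z : A × B, P.real {ω | U ω = z.1 ∧ V ω = z.2} = 1 := by
  -- With a constant first variable, the marginal formula expresses the total mass as the sum over
  -- the values of the pair.
  have h := measureReal_eq_sum_snd (P := P) (measurable_const (a := ())) (hU.prodMk hV) ()
  simpa [Prod.ext_iff] using h.symm

end MutualInfo

/-! ### Data frames with missing values -/

/-- When `s n` holds, `n` is the entry of index `Nat.count s n` in the enumeration of `s`. Counting
in the observed rows thus becomes counting in an initial segment of a subsequence. -/
theorem natCount_and_eq_natCount_nth (s r : ℕ → Prop) [DecidablePred s] [DecidablePred r] (n : ℕ) :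
    Nat.count (fun k => s k ∧ r k) n = Nat.count (fun m => r (Nat.nth s m)) (Nat.count s n) := by
  induction n with
  | zero => simp
  | succ n ih =>
    by_cases hs : s n
    · simp [Nat.count_succ, ih, hs, Nat.nth_count hs]
    · simp [Nat.count_succ, ih, hs]

section Frame

variable {p : ℕ} {α : Fin p → ℕ}

theorem mask_eq_some_iff (x : ℕ → (i : Fin p) → Fin (α i)) (y : ℕ → Fin p → Bool) (k : ℕ)
    (i : Fin p) (u : Fin (α i)) : mask x y k i = some u ↔ y k i = true ∧ x k i = u := by
  simp [mask]

theorem rows_comm (d : Frame α) (n : ℕ) (i j : Fin p) : rows d n j i = rows d n i j := by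
  simp only [rows, and_comm]

theorem count_rows_fst (d : Frame α) (n : ℕ) (i j : Fin p) :
    count d (rows d n i j) i = fun u => ∑ v, pairCount d (rows d n i j) i j (u, v) := by
  funext u
  have h := Finset.card_eq_sum_card_fiberwise (f := fun k => d k j)
    (s := (rows d n i j).filter fun k => d k i = some u)
    (t := Finset.univ.map Function.Embedding.some) fun k hk => by
      obtain ⟨v, hv⟩ := Option.isSome_iff_exists.1
        (Finset.mem_filter.1 (Finset.mem_filter.1 (Finset.mem_coe.1 hk)).1).2.2
      simp [hv]
  rw [Finset.sum_map] at h
  simpa only [count, pairCount, Finset.filter_filter, Function.Embedding.some_apply] using h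

theorem pairCount_swap (d : Frame α) (S : Finset ℕ) (i j : Fin p) (u : Fin (α i)) (v : Fin (α j)) :
    pairCount d S j i (v, u) = pairCount d S i j (u, v) := by
  simp only [pairCount, and_comm]

theorem count_rows_snd (d : Frame α) (n : ℕ) (i j : Fin p) :
    count d (rows d n j i) j = fun v => ∑ u, pairCount d (rows d n i j) i j (u, v) := by
  rw [count_rows_fst, rows_comm d n i j]
  simp only [pairCount_swap d _ i j]

theorem log_q_ratio_eq_logRatio (a : (i : Fin p) → Fin (α i) → ℝ)
    (b : (i j : Fin p) → Fin (α i) × Fin (α j) → ℝ) (d : Frame α) (n : ℕ) (i j : Fin p) :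
    Real.log (qJoint b d n i j / (qMarg a d n i j * qMarg a d n j i)) =
      logRatio (a i) (a j) (b i j) (pairCount d (rows d n i j) i j) := by
  rw [qJoint, qMarg, qMarg, count_rows_fst, count_rows_snd, logRatio]

theorem numObs_mask (x : ℕ → (i : Fin p) → Fin (α i)) (y : ℕ → Fin p → Bool) (n : ℕ)
    (i j : Fin p) :
    numObs (mask x y) n i j = Nat.count (fun k => y k i = true ∧ y k j = true) n := by
  have h : ∀ k l, (mask x y k l).isSome ↔ y k l = true := fun k l => by simp [mask]
  simp only [numObs, rows, h, Nat.count_eq_card_filter_range]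

theorem pairCount_mask (x : ℕ → (i : Fin p) → Fin (α i)) (y : ℕ → Fin p → Bool) (n : ℕ)
    (i j : Fin p) (z : Fin (α i) × Fin (α j)) :
    pairCount (mask x y) (rows (mask x y) n i j) i j z =
      Nat.count (fun k => (y k i = true ∧ y k j = true) ∧ (x k i, x k j) = z) n := by
  rw [pairCount, rows, Finset.filter_filter, Nat.count_eq_card_filter_range]
  congr 1
  refine Finset.filter_congr fun k _ => ?_
  simp only [mask_eq_some_iff, Prod.ext_iff]
  constructor
  · rintro ⟨-, ⟨h1, h2⟩, h3, h4⟩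
    exact ⟨⟨h1, h3⟩, h2, h4⟩
  · rintro ⟨⟨h1, h3⟩, h2, h4⟩
    exact ⟨by simp [mask, h1, h3], ⟨h1, h2⟩, h3, h4⟩

theorem pairCount_mask_eq_seqCount (x : ℕ → (i : Fin p) → Fin (α i)) (y : ℕ → Fin p → Bool)
    (n : ℕ) (i j : Fin p) :
    pairCount (mask x y) (rows (mask x y) n i j) i j =
      seqCount (fun m => (x (Nat.nth (fun k => y k i = true ∧ y k j = true) m) i,
        x (Nat.nth (fun k => y k i = true ∧ y k j = true) m) j))
        (Nat.count (fun k => y k i = true ∧ y k j = true) n) := by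
  funext z
  rw [pairCount_mask, natCount_and_eq_natCount_nth (fun k => y k i = true ∧ y k j = true)
    (fun k => (x k i, x k j) = z), Nat.count_eq_card_filter_range, seqCount]

theorem measurable_natCount {E : Type*} [MeasurableSpace E] {s : ℕ → E → Prop}
    [∀ k q, Decidable (s k q)] (hs : ∀ k, MeasurableSet {q | s k q}) (n : ℕ) :
    Measurable fun q => Nat.count (fun k => s k q) n := by
  induction n with
  | zero => simp
  | succ n ih =>
    simp only [Nat.count_succ]
    exact ih.add (Measurable.ite (hs n) measurable_const measurable_const)

theorem measurableSet_observed (i j : Fin p) (k : ℕ) :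
    MeasurableSet {q : (ℕ → Fin p → Bool) × (ℕ → (i : Fin p) → Fin (α i)) |
      q.1 k i = true ∧ q.1 k j = true} := by
  have h : ∀ l, Measurable fun q : (ℕ → Fin p → Bool) × (ℕ → (i : Fin p) → Fin (α i)) =>
      q.1 k l := fun l => by fun_prop
  exact (h i (measurableSet_singleton true)).inter (h j (measurableSet_singleton true))

theorem measurable_numObs_mask (i j : Fin p) (n : ℕ) :
    Measurable fun q : (ℕ → Fin p → Bool) × (ℕ → (i : Fin p) → Fin (α i)) =>
      numObs (mask q.2 q.1) n i j := by
  simp only [numObs_mask]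
  exact measurable_natCount (measurableSet_observed i j) n

theorem measurable_pairCount_mask (i j : Fin p) (n : ℕ) :
    Measurable fun q : (ℕ → Fin p → Bool) × (ℕ → (i : Fin p) → Fin (α i)) =>
      pairCount (mask q.2 q.1) (rows (mask q.2 q.1) n i j) i j := by
  refine measurable_pi_lambda _ fun z => ?_
  simp only [pairCount_mask]
  refine measurable_natCount (fun k => ?_) n
  have h : Measurable fun q : (ℕ → Fin p → Bool) × (ℕ → (i : Fin p) → Fin (α i)) =>
      (q.2 k i, q.2 k j) := by fun_prop
  exact (measurableSet_observed i j k).inter (h (measurableSet_singleton z))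

/-- This is the measurability needed for Fubini. `T` may be arbitrary because there are only
countably many tables of counts. -/
theorem measurableSet_eventually_of_tendsto (i j : Fin p)
    (T : Set (Fin (α i) × Fin (α j) → ℕ)) :
    MeasurableSet {q : (ℕ → Fin p → Bool) × (ℕ → (i : Fin p) → Fin (α i)) |
      Tendsto (fun n => numObs (mask q.2 q.1) n i j) atTop atTop →
        ∀ᶠ n in atTop, pairCount (mask q.2 q.1) (rows (mask q.2 q.1) n i j) i j ∈ T} := by
  refine (measurableSet_tendsto atTop (measurable_numObs_mask i j)).imp ?_
  have h := MeasurableSet.measurableSet_liminf fun n =>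
    measurable_pairCount_mask (α := α) i j n T.to_countable.measurableSet
  convert h using 1
  ext q
  simp [mem_liminf_iff_eventually_mem]

end Frame

/-! ### Reduction to deterministic patterns. -/

section Fubini

variable {Ω : Type*} [MeasurableSpace Ω] {P : Measure Ω} [IsProbabilityMeasure P] {p : ℕ}
  {α : Fin p → ℕ} {X : ℕ → Ω → (i : Fin p) → Fin (α i)}

/-- The rows selected by a deterministic pattern of missing values are independent samples. -/
theorem ae_isTypicalCounts_nth (hXmeas : ∀ k, Measurable (X k)) (hXindep : iIndepFun X P)
    (hXident : ∀ k, IdentDistrib (X k) (X 0) P P) (i j : Fin p) {s : ℕ → Prop}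
    (hs : {k | s k}.Infinite) :
    ∀ᵐ ω ∂P, IsTypicalCounts
      (fun z : Fin (α i) × Fin (α j) => P.real {ω | X 0 ω i = z.1 ∧ X 0 ω j = z.2})
      (seqCount fun m => (X (Nat.nth s m) ω i, X (Nat.nth s m) ω j)) := by
  have hg : Measurable fun x : (i : Fin p) → Fin (α i) => (x i, x j) := by fun_prop
  refine ae_isTypicalCounts (Z := fun m ω => (X (Nat.nth s m) ω i, X (Nat.nth s m) ω j))
    (fun m => hg.comp (hXmeas _))
    ((hXindep.precomp (Nat.nth_injective hs)).comp (fun _ x => (x i, x j)) fun _ => hg)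
    fun m z => ?_
  have h := (hXident (Nat.nth s m)).measure_mem_eq (hg (measurableSet_singleton z))
  simpa [Measure.real, Set.preimage, Prod.ext_iff] using congrArg ENNReal.toReal h

/-- It suffices to treat deterministic patterns of missing values. -/
theorem ae_of_forall_pattern (hXmeas : ∀ k, Measurable (X k)) {Y : ℕ → Ω → Fin p → Bool}
    (hYmeas : ∀ k, Measurable (Y k))
    (hXY : IndepFun (fun ω k => X k ω) (fun ω k => Y k ω) P)
    {G : (ℕ → Fin p → Bool) × (ℕ → (i : Fin p) → Fin (α i)) → Prop}
    (hG : MeasurableSet {q | G q}) (h : ∀ y, ∀ᵐ ω ∂P, G (y, fun k => X k ω)) :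
    ∀ᵐ ω ∂P, G (fun k => Y k ω, fun k => X k ω) := by
  have hX : Measurable fun ω k => X k ω := measurable_pi_lambda _ hXmeas
  have hY : Measurable fun ω k => Y k ω := measurable_pi_lambda _ hYmeas
  have hmap := (indepFun_iff_map_prod_eq_prod_map_map hY.aemeasurable hX.aemeasurable).1 hXY.symm
  have := Measure.isProbabilityMeasure_map (μ := P) hX.aemeasurable
  have := Measure.isProbabilityMeasure_map (μ := P) hY.aemeasurable
  rw [← ae_map_iff (p := G) (hY.prodMk hX).aemeasurable hG, hmap, Measure.ae_prod_iff_ae_ae hG]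
  refine ae_of_all _ fun y => ?_
  exact (ae_map_iff (p := fun x => G (y, x)) hX.aemeasurable (measurable_prodMk_left hG)).2 (h y)

end Fubini

end IncompleteData

/-! ### The equivalences for both estimators. -/

theorem proposition4 {Ω : Type*} [MeasurableSpace Ω] (P : Measure Ω) [IsProbabilityMeasure P]
    {p : ℕ} (α : Fin p → ℕ) (hα : ∀ i, 2 ≤ α i)
    -- the complete samples, independent and identically distributed
    (X : ℕ → Ω → (i : Fin p) → Fin (α i))
    (hXmeas : ∀ k, Measurable (X k))
    (hXindep : iIndepFun X P)
    (hXident : ∀ k, IdentDistrib (X k) (X 0) P P)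
    -- `Y k ω i` tells whether the value `X k ω i` is observed; the pattern of missing
    -- values is an arbitrary process that is independent of the samples
    (Y : ℕ → Ω → Fin p → Bool)
    (hYmeas : ∀ k, Measurable (Y k))
    (hXY : IndepFun (fun ω k => X k ω) (fun ω k => Y k ω) P)
    -- positive parameters of the Bayes measures
    (a : (i : Fin p) → Fin (α i) → ℝ) (ha : ∀ i x, 0 < a i x)
    (b : (i j : Fin p) → Fin (α i) × Fin (α j) → ℝ) (hb : ∀ i j, i ≠ j → ∀ z, 0 < b i j z)
    -- every value is really taken; this is not needed when all the parameters are `1 / 2`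
    (hsupp : (∀ i x, 0 < P.real {ω | X 0 ω i = x}) ∨
      ((∀ i x, a i x = 1 / 2) ∧ ∀ i j, i ≠ j → ∀ z, b i j z = 1 / 2))
    (hobs : ∀ i j, i ≠ j → ∀ᵐ ω ∂P,
      Tendsto (fun n => IncompleteData.numObs
        (IncompleteData.mask (fun k => X k ω) (fun k => Y k ω)) n i j) atTop atTop) :
    ∀ᵐ ω ∂P, ∀ᶠ n in atTop, ∀ i j, i ≠ j →
      (IncompleteData.estJ a b (IncompleteData.mask (fun k => X k ω) (fun k => Y k ω)) n i j ≤ 0 ↔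
        IncompleteData.mutualInfo P (fun ω' => X 0 ω' i) (fun ω' => X 0 ω' j) = 0) ∧
      (IncompleteData.mutualInfo P (fun ω' => X 0 ω' i) (fun ω' => X 0 ω' j) = 0 ↔
        IncompleteData.estK a b (IncompleteData.mask (fun k => X k ω) (fun k => Y k ω)) n i j ≤ 0) :=
  by
  open IncompleteData in
  -- The divergence of `n(i,j)` stays inside the event: the claim is to hold for every fixed
  -- pattern, and it is vacuous for those with finitely many common observations.
  have key : ∀ i j, i ≠ j → ∀ᵐ ω ∂P,
      Tendsto (fun n => numObs (mask (fun k => X k ω) (fun k => Y k ω)) n i j) atTop atTop →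
      ∀ᶠ n in atTop, pairCount (mask (fun k => X k ω) (fun k => Y k ω))
        (rows (mask (fun k => X k ω) (fun k => Y k ω)) n i j) i j ∈
          {c | logRatio (a i) (a j) (b i j) c ≤ 0 ↔
            mutualInfo P (fun ω' => X 0 ω' i) (fun ω' => X 0 ω' j) = 0} := by
    intro i j hij
    refine ae_of_forall_pattern hXmeas hYmeas hXY (measurableSet_eventually_of_tendsto i j _)
      fun y => ?_
    simp only [numObs_mask, pairCount_mask_eq_seqCount]
    by_cases htend :
      Tendsto (fun n => Nat.count (fun k => y k i = true ∧ y k j = true) n) atTop atTop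
    swap
    · exact ae_of_all _ fun ω h => absurd h htend
    have hinf : {k | y k i = true ∧ y k j = true}.Infinite := by
      intro hfin
      obtain ⟨n, hn⟩ := (htend.eventually_gt_atTop hfin.toFinset.card).exists
      exact hn.not_ge (Nat.count_le_card hfin n)
    have hm : ∀ l, Measurable fun ω => X 0 ω l := fun l => (measurable_pi_apply l).comp (hXmeas 0)
    filter_upwards [ae_isTypicalCounts_nth hXmeas hXindep hXident i j hinf] with ω hω _
    -- What holds for all large sample sizes `N` is pulled back along `n ↦ n(i,j)`.
    refine htend.eventually (p := fun N => logRatio (a i) (a j) (b i j) (seqCount _ N) ≤ 0 ↔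
      mutualInfo P (fun ω' => X 0 ω' i) (fun ω' => X 0 ω' j) = 0) ?_
    rw [mutualInfo_eq_pmfMutualInfo (hm i) (hm j)]
    refine hω.eventually_logRatio_nonpos_iff (fun _ => measureReal_nonneg)
      (sum_measureReal_pair (hm i) (hm j)) (by simpa using hα i) (by simpa using hα j)
      (ha i) (ha j) (hb i j hij) ?_
    simp only [← measureReal_eq_sum_snd (hm i) (hm j), ← measureReal_eq_sum_fst (hm i) (hm j)]
    exact hsupp.imp (fun h => ⟨h i, h j⟩) fun h => ⟨h.1 i, h.1 j, h.2 i j hij⟩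
  have hall := ae_all_iff.2 fun i => ae_all_iff.2 fun j => ae_all_iff.2 fun hij : i ≠ j =>
    (hobs i j hij).and (key i j hij)
  filter_upwards [hall] with ω hω
  refine eventually_all.2 fun i => eventually_all.2 fun j => ?_
  by_cases hij : i = j
  · exact Eventually.of_forall fun n h => absurd hij h
  obtain ⟨h1, h2⟩ := hω i j hij
  -- Once `n` and `n(i,j)` are positive, the normalising factors do not affect the sign; at `n(i,j)
  -- = 0` the factor of `estK` would be `1 / 0 = 0`.
  filter_upwards [h2 h1, h1.eventually_gt_atTop 0, eventually_gt_atTop 0] with n hn hN h0 _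
  have hpos : ∀ (N : ℕ) (r : ℝ), 0 < N → (1 / (N : ℝ) * r ≤ 0 ↔ r ≤ 0) := fun N r hN =>
    mul_nonpos_iff_pos_imp_nonpos.trans (by
      have : (0 : ℝ) < 1 / N := by positivity
      exact ⟨fun h => h.1 this, fun h => ⟨fun _ => h, fun _ => this.le⟩⟩)
  rw [IncompleteData.estJ, IncompleteData.estK, IncompleteData.log_q_ratio_eq_logRatio,
    hpos _ _ h0, hpos _ _ hN]
  exact ⟨hn, hn.symm⟩
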